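/- Let $G$ be the three-dimensional Heisenberg group (real upper unitriangular $3\times 3$ matrices) and let $g_0$ be a left-invariant Riemannian metric on $G$. Then there is a Milnor frame for $g_0$, i.e. a left-invariant frame $F_1,F_2,F_3$ with dual coframe $\omega^1,\omega^2,\omega^3$ such that $[F_2,F_3]=-2F_1$, $[F_3,F_1]=[F_1,F_2]=0$ and $g_0=A_0\,\omega^1\otimes\omega^1+B_0\,\omega^2\otimes\omega^2+C_0\,\omega^3\otimes\omega^3$ with constants $A_0,B_0,C_0>0$; and there is a solution $g(t)$, $0\le t<\infty$, of the Ricci flow $\partial_t g=-2\,\mathrm{Ric}_g$ by left-invariant metrics with $g(0)=g_0$. For every such frame, every such solution and every compact set $K\subset G$, the $L^1$-norm $C_K(g)=\int_K|C_2|_g\,d\mu_g$ of the Cotton–York tensor $C_{ij}=g_{ik}\varepsilon^{klm}\left(\nabla_lR_{mj}-\tfrac14\nabla_lR\,g_{mj}\right)$ (where $|C_2|_g^2=g^{ip}g^{jq}C_{ij}C_{pq}$) satisfies $$C_K(g(t))=4\sqrt6\,A_0^{2/3}B_0^{1/3}C_0^{1/3}\left(12t+\frac{B_0C_0}{A_0}\right)^{-4/3}\mathrm{Vol}(K,h)\qquad(t\ge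 0),$$ where $h=\omega^1\otimes\omega^1+\omega^2\otimes\omega^2+\omega^3\otimes\omega^3$. Consequently $C_K(g(t))\to 0$ as $t\to\infty$, and if $\mathrm{Vol}(K,h)>0$, then $t\mapsto C_K(g(t))$ is strictly decreasing on $[0,\infty)$. -/

import Mathlib

open Set Filter Topology MeasureTheory
open scoped Matrix ContDiff

namespace CottonFlow

/-- Coordinate space `ℝ³` (coordinates are numbered `0, 1, 2`). -/
abbrev E3 : Type := Fin 3 → ℝ

/-! ### The Heisenberg group in its global chart -/

/-- The element of the Heisenberg group with coordinates `p`, as the real upper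
unitriangular matrix `(1 x z; 0 1 y; 0 0 1)`. -/
def unitriangular (p : E3) : Matrix (Fin 3) (Fin 3) ℝ :=
  !![1, p 0, p 2; 0, 1, p 1; 0, 0, 1]

/-- The Heisenberg group law in the coordinates `(x, y, z)` of `unitriangular`. -/
def heisMul (p q : E3) : E3 := ![p 0 + q 0, p 1 + q 1, p 2 + q 2 + p 0 * q 1]

/-- The group law is matrix multiplication. -/
theorem unitriangular_heisMul (p q : E3) :
    unitriangular (heisMul p q) = unitriangular p * unitriangular q := by
  ext i j
  fin_cases i <;> fin_cases j <;>
    simp [unitriangular, heisMul, Matrix.mul_apply, Fin.sum_univ_three] <;> ring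

/-! ### Riemannian geometry on `ℝ³` in coordinates -/

/-- A field of `3 × 3` matrices on `ℝ³`: the components `T i j` of a `(0,2)`-tensor field. -/
abbrev TensorField : Type := E3 → Matrix (Fin 3) (Fin 3) ℝ

/-- A smooth Riemannian metric, by its components `g x i j = g_{ij}(x)`. -/
structure IsRiemannianMetric (g : TensorField) : Prop where
  smooth : ∀ i j, ContDiff ℝ ∞ (fun x => g x i j)
  posDef : ∀ x, (g x).PosDef

/-- The partial derivative `∂_i f`. -/
noncomputable def pd (i : Fin 3) (f : E3 → ℝ) (x : E3) : ℝ :=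
  fderiv ℝ f x (Pi.single i 1)

/-- Christoffel symbols of the Levi-Civita connection:
`Γ^k_{ij} = ½ g^{kl} (∂_i g_{jl} + ∂_j g_{il} - ∂_l g_{ij})`. -/
noncomputable def christoffel (g : TensorField) (k i j : Fin 3) (x : E3) : ℝ :=
  (1 / 2) * ∑ l, (g x)⁻¹ k l *
    (pd i (fun y => g y j l) x + pd j (fun y => g y i l) x - pd l (fun y => g y i j) x)

/-- The Ricci tensor
`R_{ij} = ∂_k Γ^k_{ij} - ∂_j Γ^k_{ik} + Γ^k_{kl} Γ^l_{ij} - Γ^k_{jl} Γ^l_{ik}`. -/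
noncomputable def ricci (g : TensorField) : TensorField := fun x => Matrix.of fun i j =>
  ∑ k, (pd k (christoffel g k i j) x - pd j (christoffel g k i k) x)
    + ∑ k, ∑ l, (christoffel g k k l x * christoffel g l i j x
        - christoffel g k j l x * christoffel g l i k x)

/-- The scalar curvature `R = g^{ij} R_{ij}`. -/
noncomputable def scalarCurv (g : TensorField) (x : E3) : ℝ :=
  ∑ i, ∑ j, (g x)⁻¹ i j * ricci g x i j

/-- The covariant derivative `∇_l T_{mj}` of a `(0,2)`-tensor field. -/
noncomputable def nabla (g T : TensorField) (l m j : Fin 3) (x : E3) : ℝ :=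
  pd l (fun y => T y m j) x
    - ∑ p, christoffel g p l m x * T x p j - ∑ p, christoffel g p l j x * T x m p

/-- The completely antisymmetric symbol `η^{klm}` (index arithmetic is modulo 3). -/
noncomputable def eta (k l m : Fin 3) : ℝ :=
  if l = k + 1 ∧ m = k + 2 then 1 else if l = k + 2 ∧ m = k + 1 then -1 else 0

/-- The tensor `ε^{klm} = η^{klm} / √(det g)`. -/
noncomputable def eps (g : TensorField) (k l m : Fin 3) (x : E3) : ℝ :=
  eta k l m / Real.sqrt (g x).det

/-- The Cotton–York tensor `C_{ij} = g_{ik} ε^{klm} (∇_l R_{mj} - ¼ ∇_l R g_{mj})`. -/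
noncomputable def cottonYork (g : TensorField) : TensorField := fun x => Matrix.of fun i j =>
  ∑ k, ∑ l, ∑ m, g x i k * eps g k l m x *
    (nabla g (ricci g) l m j x - (1 / 4) * pd l (scalarCurv g) x * g x m j)

/-- The pointwise norm `|T|_g = (g^{ip} g^{jq} T_{ij} T_{pq})^{1/2}`. -/
noncomputable def tensorNorm (g T : TensorField) (x : E3) : ℝ :=
  Real.sqrt (∑ i, ∑ j, ∑ p, ∑ q, (g x)⁻¹ i p * (g x)⁻¹ j q * T x i j * T x p q)

/-- The Riemannian measure `dμ_g = √(det g) dx`. -/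
noncomputable def riemVol (g : TensorField) : Measure E3 :=
  volume.withDensity fun x => ENNReal.ofReal (Real.sqrt (g x).det)

/-- `C_K(g) = ∫_K |C₂|_g dμ_g`, the `L¹`-norm of the Cotton–York tensor on `K`. -/
noncomputable def cottonL1 (K : Set E3) (g : TensorField) : ℝ :=
  ∫ x in K, tensorNorm g (cottonYork g) x ∂(riemVol g)

/-- `g t`, `0 ≤ t < ∞`, is a solution of the Ricci flow `∂g/∂t = -2 Ric_g`
(with a one-sided derivative at `t = 0`; values at `t < 0` play no role). -/
structure IsRicciFlow (g : ℝ → TensorField) : Prop where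
  metric : ∀ t, 0 ≤ t → IsRiemannianMetric (g t)
  flow : ∀ t, 0 ≤ t → ∀ x i j,
    HasDerivWithinAt (fun s => g s x i j) (-2 * ricci (g t) x i j) (Ici 0) t

/-! ### Left-invariant objects on the Heisenberg group -/

/-- Every left translation `L_p` is an isometry of `g`: `(L_p)^* g = g`. -/
def IsLeftInvariantMetric (g : TensorField) : Prop :=
  ∀ p q u v : E3,
    (fderiv ℝ (heisMul p) q u) ⬝ᵥ (g (heisMul p q) *ᵥ (fderiv ℝ (heisMul p) q v))
      = u ⬝ᵥ (g q *ᵥ v)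

/-- `dL_p (V) = V` for every left translation `L_p`. -/
def IsLeftInvariantField (V : E3 → E3) : Prop :=
  ∀ p q : E3, fderiv ℝ (heisMul p) q (V q) = V (heisMul p q)

/-- The dual coframe of a frame `F`: row `i` of `coframe F x` is the covector `ω^i` at `x`. -/
noncomputable def coframe (F : Fin 3 → E3 → E3) (x : E3) : Matrix (Fin 3) (Fin 3) ℝ :=
  (Matrix.of fun a i => F i x a)⁻¹

/-- The metric `d₀ ω¹ ⊗ ω¹ + d₁ ω² ⊗ ω² + d₂ ω³ ⊗ ω³` for the dual coframe of `F`. -/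
noncomputable def diagMetric (F : Fin 3 → E3 → E3) (d : Fin 3 → ℝ) : TensorField :=
  fun x => Matrix.of fun a b => ∑ i, d i * coframe F x i a * coframe F x i b

/-- `(F 0, F 1, F 2)` is a Milnor frame `(F₁, F₂, F₃)` for the metric `g₀` on the Heisenberg
group: a left-invariant frame with `[F₂, F₃] = -2 F₁`, `[F₃, F₁] = [F₁, F₂] = 0` and
`g₀ = A₀ ω¹ ⊗ ω¹ + B₀ ω² ⊗ ω² + C₀ ω³ ⊗ ω³`, where `A₀, B₀, C₀ > 0`. -/
structure IsMilnorFrame (g₀ : TensorField) (F : Fin 3 → E3 → E3) (A₀ B₀ C₀ : ℝ) : Prop where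
  leftInvariant : ∀ i, IsLeftInvariantField (F i)
  frame : ∀ x, LinearIndependent ℝ fun i => F i x
  bracket₂₃ : ∀ x, VectorField.lieBracket ℝ (F 1) (F 2) x = (-2 : ℝ) • F 0 x
  bracket₃₁ : ∀ x, VectorField.lieBracket ℝ (F 2) (F 0) x = 0
  bracket₁₂ : ∀ x, VectorField.lieBracket ℝ (F 0) (F 1) x = 0
  posA : 0 < A₀
  posB : 0 < B₀
  posC : 0 < C₀
  diagonal : g₀ = diagMetric F ![A₀, B₀, C₀]

end CottonFlow

open CottonFlow

/-! ### Normal form of a left-invariant metric. -/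

namespace CottonFlow

/-! Completing the square along the centre `∂_z` writes every left-invariant metric as `a θ² + S`,
with `θ` a left-invariant contact form and `S` a constant form in `dx, dy` (`exists_eq_heisMetric`).
Storing `S` by its inverse `(P, Q; Q, R)` keeps connection and Ricci tensor polynomial, and every
component depends on the point only through `b = β - x`. Put `Δ = PR - Q²`. Then `Ric = (aΔ/2)(aθ² -
S)`, the scalar curvature is constant, and the Cotton–York tensor is a multiple of `2aθ² - S`. The
volume density cancels in its `L¹`-norm, leaving `√(3/2) a²Δ` times the Lebesgue volume of `K`. With
`D = det g = a/Δ`, the flow gives the closed system `a' = -a³/D`, `D' = a²`. Hence `aD` is conserved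
and `D/a²` grows with slope 3, so `a³ = (aD)/(D/a²)` is explicit for every left-invariant solution;
neither uniqueness of the flow nor preservation of a diagonal form is needed. A Milnor frame has `F₁
= c ∂_z` and determinant `-2c²`, which translates `a`, `D` and Lebesgue volume into `A₀, B₀, C₀` and
`h`; the powers of `c` cancel. -/

/-- The left-invariant contact form `θ = α dx + (β - x) dy + dz`, as a function of `b = β - x`. -/
def contactForm (α b : ℝ) : Fin 3 → ℝ := ![α, b, 1]

/-- The horizontal form `(p dx² + 2 q dx dy + r dy²)` whose `2 × 2` inverse is `(P, Q; Q, R)`. -/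
noncomputable def horizontalForm (P Q R : ℝ) : Matrix (Fin 3) (Fin 3) ℝ :=
  (P * R - Q ^ 2)⁻¹ • !![R, -Q, 0; -Q, P, 0; 0, 0, 0]

/-- The left-invariant metric `a θ ⊗ θ + S`. -/
noncomputable def heisMetric (a α β P Q R : ℝ) : TensorField := fun x => Matrix.of fun i j =>
  a * contactForm α (β - x 0) i * contactForm α (β - x 0) j + horizontalForm P Q R i j

/-- The vector raised from `s dx + t dy`, for `(s, t)` a column of `(P, Q; Q, R)`. -/
def raisedCol (α s t b : ℝ) : Fin 3 → ℝ := ![s, t, -(α * s + b * t)]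

/-- The components of the inverse of `heisMetric`. -/
noncomputable def heisInv (a α P Q R b : ℝ) : Matrix (Fin 3) (Fin 3) ℝ :=
  Matrix.of fun i j => raisedCol α P Q b i * ![1, 0, -α] j + raisedCol α Q R b i * ![0, 1, -b] j
    + ![0, 0, 1] i * ![0, 0, a⁻¹] j

theorem heisMetric_det {a P Q R : ℝ} (α β : ℝ) (hΔ : P * R - Q ^ 2 ≠ 0) (x : E3) :
    (heisMetric a α β P Q R x).det = a / (P * R - Q ^ 2) := by
  simp [Matrix.det_fin_three, heisMetric, contactForm, horizontalForm]
  field_simp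
  ring

theorem heisMetric_inv {a P Q R : ℝ} (α β : ℝ) (ha : a ≠ 0) (hΔ : P * R - Q ^ 2 ≠ 0) (x : E3) :
    (heisMetric a α β P Q R x)⁻¹ = heisInv a α P Q R (β - x 0) := by
  apply Matrix.inv_eq_right_inv
  ext i j
  fin_cases i <;> fin_cases j <;>
    simp [Matrix.mul_apply, Fin.sum_univ_three, heisMetric, contactForm, horizontalForm, heisInv,
      raisedCol] <;> field_simp <;> ring

/-! ### Connection and curvature by one-variable calculus in `b`. -/

theorem hasDerivAt_contactForm (α b : ℝ) (i : Fin 3) :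
    HasDerivAt (fun b => contactForm α b i) (![0, 1, 0] i) b := by
  fin_cases i
  · exact hasDerivAt_const _ _
  · exact hasDerivAt_id _
  · exact hasDerivAt_const _ _

theorem hasDerivAt_raisedCol (α s t b : ℝ) (i : Fin 3) :
    HasDerivAt (fun b => raisedCol α s t b i) (![0, 0, -t] i) b := by
  fin_cases i
  · exact hasDerivAt_const _ _
  · exact hasDerivAt_const _ _
  · simpa [raisedCol] using (((hasDerivAt_id b).mul_const t).const_add (α * s)).fun_neg

theorem pd_comp {φ : ℝ → ℝ} {φ' β : ℝ} {x : E3} (h : HasDerivAt φ φ' (β - x 0)) (i : Fin 3) :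
    pd i (fun y => φ (β - y 0)) x = -φ' * (![1, 0, 0] : Fin 3 → ℝ) i := by
  have h0 : HasFDerivAt (fun y : E3 => β - y 0)
      (-(ContinuousLinearMap.proj (R := ℝ) (φ := fun _ : Fin 3 => ℝ) 0)) x :=
    (ContinuousLinearMap.proj (R := ℝ) (φ := fun _ : Fin 3 => ℝ) 0).hasFDerivAt.const_sub β
  have h1 := h.comp_hasFDerivAt x h0
  unfold pd
  erw [h1.fderiv]
  fin_cases i <;> simp

theorem pd_const_fun (c : ℝ) (i : Fin 3) (x : E3) : pd i (fun _ => c) x = 0 := by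
  simp [pd]

/-- The Christoffel symbols of `heisMetric`. -/
noncomputable def heisChristoffel (a α P Q R : ℝ) (k i j : Fin 3) (b : ℝ) : ℝ :=
  -(1 / 2) * (![1, 0, 0] i * (![0, 1, 0] j * ![0, 0, 1] k
        + a * contactForm α b j * raisedCol α Q R b k)
    + ![1, 0, 0] j * (![0, 1, 0] i * ![0, 0, 1] k + a * contactForm α b i * raisedCol α Q R b k)
    - a * raisedCol α P Q b k * (![0, 1, 0] i * contactForm α b j + contactForm α b i * ![0, 1, 0] j))

theorem pd_heisMetric (a α β P Q R : ℝ) (l i j : Fin 3) (x : E3) :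
    pd l (fun y => heisMetric a α β P Q R y i j) x =
      -(a * (![0, 1, 0] i * contactForm α (β - x 0) j + contactForm α (β - x 0) i * ![0, 1, 0] j))
        * ![1, 0, 0] l := by
  have h := (((hasDerivAt_contactForm α (β - x 0) i).const_mul a).mul
    (hasDerivAt_contactForm α (β - x 0) j)).add_const (horizontalForm P Q R i j)
  refine (pd_comp h l).trans ?_
  ring

theorem christoffel_heisMetric {a P Q R : ℝ} (α β : ℝ) (ha : a ≠ 0) (hΔ : P * R - Q ^ 2 ≠ 0)
    (k i j : Fin 3) :
    christoffel (heisMetric a α β P Q R) k i j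
      = fun x => heisChristoffel a α P Q R k i j (β - x 0) := by
  funext x
  simp only [christoffel, pd_heisMetric, heisMetric_inv α β ha hΔ, Fin.sum_univ_three]
  fin_cases k <;> fin_cases i <;> fin_cases j <;>
    simp [heisInv, heisChristoffel, raisedCol, contactForm] <;> field_simp <;> ring

/-- The derivative of `heisChristoffel` in `b`. -/
noncomputable def heisChristoffelDeriv (a α P Q R : ℝ) (k i j : Fin 3) (b : ℝ) : ℝ :=
  -(1 / 2) * (![1, 0, 0] i *
        (a * ![0, 1, 0] j * raisedCol α Q R b k + a * contactForm α b j * ![0, 0, -R] k)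
    + ![1, 0, 0] j *
        (a * ![0, 1, 0] i * raisedCol α Q R b k + a * contactForm α b i * ![0, 0, -R] k)
    - (a * ![0, 0, -Q] k * (![0, 1, 0] i * contactForm α b j + contactForm α b i * ![0, 1, 0] j)
      + a * raisedCol α P Q b k * (![0, 1, 0] i * ![0, 1, 0] j + ![0, 1, 0] i * ![0, 1, 0] j)))

theorem hasDerivAt_heisChristoffel (a α P Q R : ℝ) (k i j : Fin 3) (b : ℝ) :
    HasDerivAt (heisChristoffel a α P Q R k i j) (heisChristoffelDeriv a α P Q R k i j b) b := by
  have hθ := hasDerivAt_contactForm α b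
  have hu := hasDerivAt_raisedCol α Q R b k
  have hv := hasDerivAt_raisedCol α P Q b k
  exact (((((((hθ j).const_mul a).mul hu).const_add _).const_mul _).add
    (((((hθ i).const_mul a).mul hu).const_add _).const_mul _)).sub
    ((hv.const_mul a).mul (((hθ j).const_mul _).add ((hθ i).mul_const _)))).const_mul _

/-- The Ricci tensor of `heisMetric`. -/
noncomputable def heisRicci (a α P Q R b : ℝ) : Matrix (Fin 3) (Fin 3) ℝ := Matrix.of fun i j =>
  a ^ 2 * (P * R - Q ^ 2) / 2 * (contactForm α b i * contactForm α b j)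
    + -(a / 2) * !![R, -Q, 0; -Q, P, 0; 0, 0, 0] i j

/-- The second term of `heisRicci` is `-(aΔ/2) S`: relative to the metric, the Ricci eigenvalues are
`aΔ/2` on the centre and `-aΔ/2` twice on `ker θ`. -/
theorem ricci_heisMetric {a P Q R : ℝ} (α β : ℝ) (ha : a ≠ 0) (hΔ : P * R - Q ^ 2 ≠ 0) :
    ricci (heisMetric a α β P Q R) = fun x => heisRicci a α P Q R (β - x 0) := by
  funext x
  ext i j
  simp only [ricci, christoffel_heisMetric α β ha hΔ, pd_comp (hasDerivAt_heisChristoffel ..),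
    Matrix.of_apply, Fin.sum_univ_three]
  fin_cases i <;> fin_cases j <;>
    simp [heisChristoffel, heisChristoffelDeriv, raisedCol, contactForm, heisRicci] <;> ring

theorem hasDerivAt_heisRicci (a α P Q R : ℝ) (i j : Fin 3) (b : ℝ) :
    HasDerivAt (fun b => heisRicci a α P Q R b i j)
      (a ^ 2 * (P * R - Q ^ 2) / 2 *
        (![0, 1, 0] i * contactForm α b j + contactForm α b i * ![0, 1, 0] j)) b :=
  (((hasDerivAt_contactForm α b i).mul (hasDerivAt_contactForm α b j)).const_mul _).add_const _

theorem scalarCurv_heisMetric {a P Q R : ℝ} (α β : ℝ) (ha : a ≠ 0) (hΔ : P * R - Q ^ 2 ≠ 0) :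
    scalarCurv (heisMetric a α β P Q R) = fun _ => -(a * (P * R - Q ^ 2) / 2) := by
  funext x
  simp only [scalarCurv, ricci_heisMetric α β ha hΔ, heisMetric_inv α β ha hΔ, Fin.sum_univ_three]
  simp [heisInv, heisRicci, raisedCol, contactForm]
  field_simp
  ring

/-! ### The Cotton–York tensor and its norm. -/

/-- The curl `η^{klm} ∇_l R_{mj}` of the Ricci tensor of `heisMetric`. -/
theorem curl_ricci_heisMetric {a P Q R : ℝ} (α β : ℝ) (ha : a ≠ 0) (hΔ : P * R - Q ^ 2 ≠ 0)
    (k j : Fin 3) (x : E3) :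
    ∑ l, ∑ m, eta k l m * nabla (heisMetric a α β P Q R) (ricci (heisMetric a α β P Q R)) l m j x
      = -(a ^ 2 * (P * R - Q ^ 2) / 2) *
        (3 * (![0, 0, 1] k * contactForm α (β - x 0) j) - (1 : Matrix (Fin 3) (Fin 3) ℝ) k j) := by
  simp only [nabla, ricci_heisMetric α β ha hΔ, christoffel_heisMetric α β ha hΔ,
    pd_comp (hasDerivAt_heisRicci ..), Fin.sum_univ_three]
  fin_cases k <;> fin_cases j <;>
    simp [eta, heisChristoffel, heisRicci, raisedCol, contactForm] <;> ring

theorem cottonYork_heisMetric {a P Q R : ℝ} (α β : ℝ) (ha : a ≠ 0) (hΔ : P * R - Q ^ 2 ≠ 0)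
    (x : E3) (i j : Fin 3) :
    cottonYork (heisMetric a α β P Q R) x i j =
      -(a ^ 2 * (P * R - Q ^ 2) / 2 / Real.sqrt (a / (P * R - Q ^ 2))) *
        (2 * a * (contactForm α (β - x 0) i * contactForm α (β - x 0) j)
          - horizontalForm P Q R i j) := by
  have key : ∀ k, ∑ l, ∑ m, heisMetric a α β P Q R x i k * eps (heisMetric a α β P Q R) k l m x *
      (nabla (heisMetric a α β P Q R) (ricci (heisMetric a α β P Q R)) l m j x
        - (1 / 4) * pd l (scalarCurv (heisMetric a α β P Q R)) x * heisMetric a α β P Q R x m j)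
      = heisMetric a α β P Q R x i k / Real.sqrt (a / (P * R - Q ^ 2)) *
        (-(a ^ 2 * (P * R - Q ^ 2) / 2) *
        (3 * (![0, 0, 1] k * contactForm α (β - x 0) j)
          - (1 : Matrix (Fin 3) (Fin 3) ℝ) k j)) := by
    intro k
    rw [← curl_ricci_heisMetric α β ha hΔ k j x, Finset.mul_sum]
    refine Finset.sum_congr rfl fun l _ => ?_
    rw [Finset.mul_sum]
    refine Finset.sum_congr rfl fun m _ => ?_
    rw [scalarCurv_heisMetric α β ha hΔ, pd_const_fun, eps, heisMetric_det α β hΔ]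
    ring
  rw [cottonYork, Matrix.of_apply, Finset.sum_congr rfl fun k _ => key k, Fin.sum_univ_three]
  generalize Real.sqrt (a / (P * R - Q ^ 2)) = s
  fin_cases i <;> fin_cases j <;>
    simp [heisMetric, horizontalForm, contactForm, Matrix.one_apply] <;> ring

/-- Relative to the metric, `2aθ² - S` has eigenvalues `2, -1, -1`, hence squared norm 6; the factor
`1/2` in the Cotton–York tensor turns this into `3/2`. -/
theorem tensorNorm_cottonYork_heisMetric {a P Q R : ℝ} (α β : ℝ) (ha : 0 < a)
    (hΔ : 0 < P * R - Q ^ 2) (x : E3) :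
    tensorNorm (heisMetric a α β P Q R) (cottonYork (heisMetric a α β P Q R)) x
      = Real.sqrt (3 / 2) * (a ^ 2 * (P * R - Q ^ 2)) / Real.sqrt (a / (P * R - Q ^ 2)) := by
  have hs : 0 < Real.sqrt (a / (P * R - Q ^ 2)) := Real.sqrt_pos.2 (div_pos ha hΔ)
  have hne := hΔ.ne'
  rw [tensorNorm, ← Real.sqrt_sq (show 0 ≤ Real.sqrt (3 / 2) * (a ^ 2 * (P * R - Q ^ 2)) /
    Real.sqrt (a / (P * R - Q ^ 2)) by positivity)]
  congr 1
  rw [div_pow, mul_pow, Real.sq_sqrt (by norm_num)]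
  simp only [cottonYork_heisMetric α β ha.ne' hΔ.ne', heisMetric_inv α β ha.ne' hΔ.ne']
  generalize Real.sqrt (a / (P * R - Q ^ 2)) = s at *
  -- Regrouping the fourfold sum into single contractions keeps the explicit expansion small.
  have e : ∀ κ : ℝ, ∀ h T : Matrix (Fin 3) (Fin 3) ℝ,
      ∑ i, ∑ j, ∑ p, ∑ q, h i p * h j q * (κ * T i j) * (κ * T p q)
        = κ ^ 2 * ∑ i, ∑ q, (∑ p, h i p * T p q) * (∑ j, T i j * h j q) := by
    intro κ h T
    simp only [Fin.sum_univ_three]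
    ring
  refine (e _ (heisInv a α P Q R (β - x 0)) (Matrix.of fun i j =>
    2 * a * (contactForm α (β - x 0) i * contactForm α (β - x 0) j)
      - horizontalForm P Q R i j)).trans ?_
  simp [Fin.sum_univ_three, heisInv, horizontalForm, contactForm, raisedCol]
  field_simp
  ring

/-! ### Left-invariant fields and metrics. -/

theorem hasFDerivAt_heisMul (p q : E3) :
    HasFDerivAt (heisMul p)
      (Matrix.mulVecLin !![1, 0, 0; 0, 1, 0; 0, p 0, 1]).toContinuousLinearMap q := by
  have h : heisMul p = fun q =>
      p + (Matrix.mulVecLin !![1, 0, 0; 0, 1, 0; 0, p 0, 1]).toContinuousLinearMap q := by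
    funext q
    ext i
    fin_cases i <;> simp [heisMul, dotProduct, Fin.sum_univ_three] <;> ring
  rw [h]
  exact (ContinuousLinearMap.hasFDerivAt _).const_add p

theorem fderiv_heisMul (p q u : E3) :
    fderiv ℝ (heisMul p) q u = ![u 0, u 1, u 2 + p 0 * u 1] := by
  rw [(hasFDerivAt_heisMul p q).fderiv]
  ext i
  fin_cases i <;> simp [Matrix.mulVec, dotProduct, Fin.sum_univ_three] <;> ring

/-- The left-invariant vector field with value `v` at the identity. -/
def leftField (v : E3) (x : E3) : E3 := ![v 0, v 1, v 2 + x 0 * v 1]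

theorem isLeftInvariantField_leftField (v : E3) : IsLeftInvariantField (leftField v) := by
  intro p q
  rw [fderiv_heisMul]
  ext i
  fin_cases i <;> simp [leftField, heisMul] <;> ring

theorem IsLeftInvariantField.eq_leftField {V : E3 → E3} (h : IsLeftInvariantField V) :
    V = leftField (V 0) := by
  funext x
  have h0 := h x 0
  have hx : heisMul x 0 = x := by
    ext i
    fin_cases i <;> simp [heisMul]
  rw [fderiv_heisMul, hx] at h0
  exact h0.symm

theorem fderiv_leftField (v x u : E3) : fderiv ℝ (leftField v) x u = ![0, 0, u 0 * v 1] := by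
  have h : leftField v = fun x =>
      v + (Matrix.mulVecLin !![0, 0, 0; 0, 0, 0; v 1, 0, 0]).toContinuousLinearMap x := by
    funext x
    ext i
    fin_cases i <;> simp [leftField, dotProduct, Fin.sum_univ_three, mul_comm]
  rw [h, ((ContinuousLinearMap.hasFDerivAt _).const_add v).fderiv]
  ext i
  fin_cases i <;> simp [Matrix.mulVec, dotProduct, Fin.sum_univ_three, mul_comm]

theorem lieBracket_leftField (v w x : E3) :
    VectorField.lieBracket ℝ (leftField v) (leftField w) x = ![0, 0, v 0 * w 1 - w 0 * v 1] := by
  rw [VectorField.lieBracket, fderiv_leftField, fderiv_leftField]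
  ext i
  fin_cases i <;> simp [leftField]

theorem IsLeftInvariantMetric.apply_eq {g : TensorField} (h : IsLeftInvariantMetric g) (x u v : E3) :
    u ⬝ᵥ (g x *ᵥ v) = ![u 0, u 1, u 2 - x 0 * u 1] ⬝ᵥ (g 0 *ᵥ ![v 0, v 1, v 2 - x 0 * v 1]) := by
  -- The left factor is the group inverse of `x`.
  have hx : heisMul ![-x 0, -x 1, -x 2 + x 0 * x 1] x = 0 := by
    ext i
    fin_cases i <;> simp [heisMul]
  have h0 := h ![-x 0, -x 1, -x 2 + x 0 * x 1] x u v
  rw [fderiv_heisMul, fderiv_heisMul, hx] at h0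
  rw [← h0]
  simp [sub_eq_add_neg]

theorem entry_eq_dotProduct (M : Matrix (Fin 3) (Fin 3) ℝ) (i j : Fin 3) :
    M i j = (Pi.single i 1 : E3) ⬝ᵥ (M *ᵥ Pi.single j 1) := by
  simp

/-- At the identity, `S` is the Schur complement of the entry `g 0 2 2`, positive definite because
`g 0` is; left translation carries the decomposition to every point. -/
theorem exists_eq_heisMetric {g : TensorField} (hg : IsRiemannianMetric g)
    (hinv : IsLeftInvariantMetric g) :
    ∃ a α β P Q R : ℝ, 0 < a ∧ 0 < P ∧ 0 < R ∧ 0 < P * R - Q ^ 2 ∧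
      g = heisMetric a α β P Q R := by
  have hpos := hg.posDef 0
  have hsymm : ∀ i j, g 0 j i = g 0 i j := fun i j => by
    simpa using hpos.isHermitian.apply i j
  have ha : 0 < g 0 2 2 := hpos.diag_pos
  have hdet : 0 < (g 0).det := hpos.det_pos
  have hp : 0 < g 0 0 0 - g 0 0 2 ^ 2 / g 0 2 2 := by
    -- This vector is `∂_x` made orthogonal to `∂_z`; its squared length is the Schur complement
    -- entry.
    have := hpos.dotProduct_mulVec_pos (x := ![1, 0, -(g 0 0 2 / g 0 2 2)])
      (fun h => by simpa using congrFun h 0)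
    simp [Matrix.mulVec, dotProduct, Fin.sum_univ_three, hsymm 0 2] at this
    have e : ∀ a b c : ℝ, 0 < a → b - c ^ 2 / a =
        b + -(c * (c / a)) + -(c / a * (c + -(c / a * a))) := by
      intro a b c h
      field_simp
      ring
    rw [e _ _ _ ha]
    linarith
  have hr : 0 < g 0 1 1 - g 0 1 2 ^ 2 / g 0 2 2 := by
    have := hpos.dotProduct_mulVec_pos (x := ![0, 1, -(g 0 1 2 / g 0 2 2)])
      (fun h => by simpa using congrFun h 1)
    simp [Matrix.mulVec, dotProduct, Fin.sum_univ_three, hsymm 1 2] at this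
    have e : ∀ a b c : ℝ, 0 < a → b - c ^ 2 / a =
        b + -(c * (c / a)) + -(c / a * (c + -(c / a * a))) := by
      intro a b c h
      field_simp
      ring
    rw [e _ _ _ ha]
    linarith
  rw [Matrix.det_fin_three, hsymm 0 1, hsymm 0 2, hsymm 1 2] at hdet
  have hd : 0 < (g 0 0 0 - g 0 0 2 ^ 2 / g 0 2 2) * (g 0 1 1 - g 0 1 2 ^ 2 / g 0 2 2)
      - (g 0 0 1 - g 0 0 2 * g 0 1 2 / g 0 2 2) ^ 2 := by
    refine (div_pos hdet ha).trans_eq ?_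
    generalize g 0 2 2 = a at *
    field_simp
    ring
  obtain ⟨p, hpe⟩ : ∃ p, p = g 0 0 0 - g 0 0 2 ^ 2 / g 0 2 2 := ⟨_, rfl⟩
  obtain ⟨r, hre⟩ : ∃ r, r = g 0 1 1 - g 0 1 2 ^ 2 / g 0 2 2 := ⟨_, rfl⟩
  obtain ⟨q, hqe⟩ : ∃ q, q = g 0 0 1 - g 0 0 2 * g 0 1 2 / g 0 2 2 := ⟨_, rfl⟩
  rw [← hpe] at hp
  rw [← hre] at hr
  rw [← hpe, ← hre, ← hqe] at hd
  have hΔ : r / (p * r - q ^ 2) * (p / (p * r - q ^ 2)) - (-q / (p * r - q ^ 2)) ^ 2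
      = (p * r - q ^ 2)⁻¹ := by
    field_simp
  refine ⟨g 0 2 2, g 0 0 2 / g 0 2 2, g 0 1 2 / g 0 2 2, r / (p * r - q ^ 2), -q / (p * r - q ^ 2),
    p / (p * r - q ^ 2), ha, div_pos hr hd, div_pos hp hd, ?_, ?_⟩
  · rw [hΔ]
    exact inv_pos.2 hd
  · funext x
    ext i j
    rw [entry_eq_dotProduct (g x), hinv.apply_eq]
    have hS : horizontalForm (r / (p * r - q ^ 2)) (-q / (p * r - q ^ 2)) (p / (p * r - q ^ 2))
        = !![p, q, 0; q, r, 0; 0, 0, 0] := by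
      rw [horizontalForm, hΔ]
      ext i j
      fin_cases i <;> fin_cases j <;> simp [mul_div_cancel₀ _ hd.ne']
    simp only [heisMetric, hS]
    have e00 : g 0 0 0 = p + g 0 0 2 ^ 2 / g 0 2 2 := by rw [hpe]; ring
    have e11 : g 0 1 1 = r + g 0 1 2 ^ 2 / g 0 2 2 := by rw [hre]; ring
    have e01 : g 0 0 1 = q + g 0 0 2 * g 0 1 2 / g 0 2 2 := by rw [hqe]; ring
    fin_cases i <;> fin_cases j <;>
      simp [Matrix.mulVec, dotProduct, Fin.sum_univ_three, contactForm, hsymm 0 1,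
        hsymm 0 2, hsymm 1 2, e00, e11, e01] <;> field_simp <;> ring

theorem isLeftInvariantMetric_heisMetric (a α β P Q R : ℝ) :
    IsLeftInvariantMetric (heisMetric a α β P Q R) := by
  intro p q u v
  simp only [fderiv_heisMul]
  simp [Matrix.mulVec, dotProduct, Fin.sum_univ_three, heisMetric, heisMul, contactForm,
    horizontalForm]
  ring

theorem isRiemannianMetric_heisMetric {a P Q R : ℝ} (α β : ℝ) (ha : 0 < a) (hP : 0 < P)
    (hΔ : 0 < P * R - Q ^ 2) : IsRiemannianMetric (heisMetric a α β P Q R) where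
  smooth i j := by
    have h : ∀ i, ContDiff ℝ ∞ fun x : E3 => contactForm α (β - x 0) i := fun i => by
      fin_cases i
      · exact contDiff_const
      · exact contDiff_const.sub (contDiff_apply ℝ ℝ 0)
      · exact contDiff_const
    exact ((contDiff_const.mul (h i)).mul (h j)).add contDiff_const
  posDef x := by
    refine Matrix.PosDef.of_dotProduct_mulVec_pos ?_ ?_
    · ext i j
      fin_cases i <;> fin_cases j <;> simp [heisMetric, contactForm, horizontalForm] <;> ring
    · intro v hv
      -- Completes the square in `S`, using `P (R v₀² - 2Q v₀v₁ + P v₁²) = (P v₁ - Q v₀)² + Δ v₀²`.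
      have e : star v ⬝ᵥ (heisMetric a α β P Q R x *ᵥ v) =
          a * (α * v 0 + (β - x 0) * v 1 + v 2) ^ 2
            + (P * R - Q ^ 2)⁻¹ * (P⁻¹ * ((P * v 1 - Q * v 0) ^ 2 + (P * R - Q ^ 2) * v 0 ^ 2)) := by
        simp [Matrix.mulVec, dotProduct, Fin.sum_univ_three, heisMetric, contactForm,
          horizontalForm]
        field_simp
        ring
      rw [e]
      by_contra hneg
      have h1 : 0 ≤ a * (α * v 0 + (β - x 0) * v 1 + v 2) ^ 2 := by positivity
      have h2 : 0 ≤ (P * v 1 - Q * v 0) ^ 2 := by positivity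
      have h3 : 0 ≤ (P * R - Q ^ 2) * v 0 ^ 2 := by positivity
      have h4 : 0 ≤ (P * R - Q ^ 2)⁻¹ *
          (P⁻¹ * ((P * v 1 - Q * v 0) ^ 2 + (P * R - Q ^ 2) * v 0 ^ 2)) := by positivity
      have h5 : a * (α * v 0 + (β - x 0) * v 1 + v 2) ^ 2 = 0 := by linarith
      have h6 : (P * R - Q ^ 2)⁻¹ *
          (P⁻¹ * ((P * v 1 - Q * v 0) ^ 2 + (P * R - Q ^ 2) * v 0 ^ 2)) = 0 := by linarith
      have h7 : (P * v 1 - Q * v 0) ^ 2 + (P * R - Q ^ 2) * v 0 ^ 2 = 0 := by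
        simpa [hP.ne', hΔ.ne'] using h6
      have v0 : v 0 = 0 := by
        have : (P * R - Q ^ 2) * v 0 ^ 2 = 0 := by linarith
        simpa [hΔ.ne'] using this
      have v1 : v 1 = 0 := by simpa [v0, hP.ne'] using h7
      have v2 : v 2 = 0 := by simpa [v0, v1, ha.ne'] using h5
      exact hv (by ext i; fin_cases i <;> simp [v0, v1, v2])

/-! ### Milnor frames. -/

/-- `F₂` and `F₃` lift an `S`-orthogonal basis of the `xy`-plane to `ker θ`. Their bracket is `∂_z`,
which forces `F₁ = -∂_z/2` and `A₀ = a/4`. -/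
theorem exists_isMilnorFrame {a P Q R : ℝ} (α β : ℝ) (ha : 0 < a) (hR : 0 < R)
    (hΔ : 0 < P * R - Q ^ 2) :
    ∃ (F : Fin 3 → E3 → E3) (A₀ B₀ C₀ : ℝ),
      IsMilnorFrame (heisMetric a α β P Q R) F A₀ B₀ C₀ := by
  -- The rows of the left factor are the coframe `-2θ`, `dx - (Q/R) dy`, `dy`.
  have hinv : ∀ x : E3, (!![-2 * α, -2 * (β - x 0), -2; 1, -(Q / R), 0; 0, 1, 0] :
      Matrix (Fin 3) (Fin 3) ℝ) * (Matrix.of fun a i => (![leftField ![0, 0, -(1 / 2)],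
        leftField ![1, 0, -α], leftField ![Q / R, 1, -β - α * (Q / R)]] :
          Fin 3 → E3 → E3) i x a) = 1 := by
    intro x
    ext i j
    fin_cases i <;> fin_cases j <;>
      simp [Matrix.mul_apply, Fin.sum_univ_three, leftField] <;> ring
  refine ⟨![leftField ![0, 0, -(1 / 2)], leftField ![1, 0, -α],
    leftField ![Q / R, 1, -β - α * (Q / R)]], a / 4, R / (P * R - Q ^ 2), 1 / R, ?_, ?_, ?_, ?_, ?_,
    by positivity, by positivity, by positivity, ?_⟩
  · intro i
    fin_cases i <;> exact isLeftInvariantField_leftField _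
  · intro x
    have hu : IsUnit (Matrix.of fun a i => (![leftField ![0, 0, -(1 / 2)],
        leftField ![1, 0, -α], leftField ![Q / R, 1, -β - α * (Q / R)]] :
          Fin 3 → E3 → E3) i x a) :=
      IsUnit.of_mul_eq_one_right _ (hinv x)
    exact Matrix.linearIndependent_cols_iff_isUnit.2 hu
  · intro x
    refine (lieBracket_leftField _ _ x).trans ?_
    ext i
    fin_cases i <;> simp [leftField]
  · intro x
    refine (lieBracket_leftField _ _ x).trans ?_
    ext i
    fin_cases i <;> simp
  · intro x
    refine (lieBracket_leftField _ _ x).trans ?_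
    ext i
    fin_cases i <;> simp
  · funext x
    have hne := hΔ.ne'
    ext i j
    simp only [diagMetric, coframe, Matrix.inv_eq_left_inv (hinv x), Matrix.of_apply,
      Fin.sum_univ_three]
    fin_cases i <;> fin_cases j <;> simp [heisMetric, contactForm, horizontalForm] <;>
      field_simp <;> ring

/-- Brackets of left-invariant fields are central, so `F₁ = -[F₂, F₃]/2` is `c ∂_z`. The same
bracket is the horizontal minor of `F₂, F₃`, which is therefore `-2c`. -/
theorem IsMilnorFrame.exists_central {g : TensorField} {F : Fin 3 → E3 → E3} {A₀ B₀ C₀ : ℝ}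
    (h : IsMilnorFrame g F A₀ B₀ C₀) :
    ∃ c : ℝ, c ≠ 0 ∧ (∀ x, F 0 x = ![0, 0, c]) ∧
      ∀ x, (Matrix.of fun a i => F i x a).det = -2 * c ^ 2 := by
  have hF := fun i => (h.leftInvariant i).eq_leftField
  have hb := h.bracket₂₃ 0
  rw [hF 1, hF 2, lieBracket_leftField] at hb
  have h0 : F 0 0 0 = 0 := by simpa using congrFun hb 0
  have h1 : F 0 0 1 = 0 := by simpa using congrFun hb 1
  have h2 : F 1 0 0 * F 2 0 1 - F 2 0 0 * F 1 0 1 = -2 * F 0 0 2 := by simpa using congrFun hb 2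
  have hx : ∀ x, F 0 x = ![0, 0, F 0 0 2] := fun x => by
    rw [hF 0]
    simp [leftField, h0, h1]
  refine ⟨F 0 0 2, fun hc => (h.frame 0).ne_zero 0 ?_, hx, fun x => ?_⟩
  · rw [hx, hc]
    simp
  · rw [Matrix.det_fin_three]
    have h10 : F 1 x 0 = F 1 0 0 := by rw [hF 1]; simp [leftField]
    have h11 : F 1 x 1 = F 1 0 1 := by rw [hF 1]; simp [leftField]
    have h20 : F 2 x 0 = F 2 0 0 := by rw [hF 2]; simp [leftField]
    have h21 : F 2 x 1 = F 2 0 1 := by rw [hF 2]; simp [leftField]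
    simp only [Matrix.of_apply, hx x, h10, h11, h20, h21]
    simp
    linear_combination F 0 0 2 * h2

theorem det_diagMetric (F : Fin 3 → E3 → E3) (d : Fin 3 → ℝ) (x : E3) :
    (diagMetric F d x).det = d 0 * d 1 * d 2 / (Matrix.of fun a i => F i x a).det ^ 2 := by
  have e : diagMetric F d x = (coframe F x)ᵀ * Matrix.diagonal d * coframe F x := by
    ext i j
    rw [diagMetric, Matrix.of_apply, Matrix.mul_apply]
    refine Finset.sum_congr rfl fun k _ => ?_
    rw [Matrix.mul_diagonal, Matrix.transpose_apply]
    ring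
  rw [e, Matrix.det_mul, Matrix.det_mul, Matrix.det_transpose, Matrix.det_diagonal, coframe,
    Matrix.det_nonsing_inv, Ring.inverse_eq_inv', Fin.prod_univ_three]
  field_simp

/-- Only `ω¹` sees the centre: `ω¹(∂_z) = 1/c`, while `ω²` and `ω³` vanish on `∂_z`. -/
theorem IsMilnorFrame.central_apply {g : TensorField} {F : Fin 3 → E3 → E3} {A₀ B₀ C₀ c : ℝ}
    (h : IsMilnorFrame g F A₀ B₀ C₀) (hc : c ≠ 0) (hF : ∀ x, F 0 x = ![0, 0, c])
    (hdet : ∀ x, (Matrix.of fun a i => F i x a).det = -2 * c ^ 2) (x : E3) :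
    g x 2 2 = A₀ / c ^ 2 := by
  have hu : coframe F x * (Matrix.of fun a i => F i x a) = 1 :=
    Matrix.nonsing_inv_mul _ (by rw [hdet]; exact (by simpa using hc))
  have hcol : ∀ i, coframe F x i 2 * c = (1 : Matrix (Fin 3) (Fin 3) ℝ) i 0 := fun i => by
    rw [← hu]
    simp [Matrix.mul_apply, Fin.sum_univ_three, hF]
  have h0 : coframe F x 0 2 = 1 / c := by
    rw [eq_div_iff hc, hcol]
    simp
  have h1 : coframe F x 1 2 = 0 := by simpa [hc] using hcol 1
  have h2 : coframe F x 2 2 = 0 := by simpa [hc] using hcol 2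
  rw [h.diagonal]
  simp [diagMetric, Fin.sum_univ_three, h0, h1, h2]
  field_simp

/-! ### The `L¹`-norm and the evolution of `a` and `D`. -/

theorem riemVol_of_det_eq {g : TensorField} {D : ℝ} (h : ∀ x, (g x).det = D) :
    riemVol g = ENNReal.ofReal (Real.sqrt D) • volume := by
  simp only [riemVol, h]
  exact withDensity_const _

theorem cottonL1_heisMetric {a P Q R : ℝ} (α β : ℝ) (ha : 0 < a) (hΔ : 0 < P * R - Q ^ 2)
    (K : Set E3) :
    cottonL1 K (heisMetric a α β P Q R)
      = Real.sqrt (3 / 2) * (a ^ 2 * (P * R - Q ^ 2)) * (volume K).toReal := by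
  have hs : 0 < Real.sqrt (a / (P * R - Q ^ 2)) := Real.sqrt_pos.2 (div_pos ha hΔ)
  simp only [cottonL1, tensorNorm_cottonYork_heisMetric α β ha hΔ]
  rw [riemVol_of_det_eq (heisMetric_det α β hΔ.ne'), setIntegral_const, measureReal_def,
    Measure.smul_apply, smul_eq_mul, smul_eq_mul, ENNReal.toReal_mul, ENNReal.toReal_ofReal hs.le]
  field_simp

theorem eq_initial_of_hasDerivWithinAt_zero {f : ℝ → ℝ}
    (h : ∀ t, 0 ≤ t → HasDerivWithinAt f 0 (Ici 0) t) {t : ℝ} (ht : 0 ≤ t) : f t = f 0 :=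
  constant_of_has_deriv_right_zero (a := 0) (b := t)
    (fun s hs => (h s hs.1).continuousWithinAt.mono fun _ hx => hx.1)
    (fun s hs => (h s hs.1).mono fun _ hx => hs.1.trans hx) t ⟨ht, le_rfl⟩

theorem hasDerivWithinAt_central {g : ℝ → TensorField} (hg : IsRicciFlow g)
    (hinv : ∀ t, 0 ≤ t → IsLeftInvariantMetric (g t)) {t : ℝ} (ht : 0 ≤ t) :
    HasDerivWithinAt (fun s => g s 0 2 2) (-(g t 0 2 2 ^ 3 / (g t 0).det)) (Ici 0) t := by
  obtain ⟨a, α, β, P, Q, R, ha, hP, hR, hΔ, e⟩ :=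
    exists_eq_heisMetric (hg.metric t ht) (hinv t ht)
  refine (hg.flow t ht 0 2 2).congr_deriv ?_
  rw [e, heisMetric_det α β hΔ.ne', ricci_heisMetric α β ha.ne' hΔ.ne']
  simp [heisMetric, heisRicci, contactForm, horizontalForm]
  field_simp

/-- Under Ricci flow `D' = -2 (scalar curvature) D = aΔD = a²`; here this is verified on the
cofactor expansion. -/
theorem hasDerivWithinAt_det {g : ℝ → TensorField} (hg : IsRicciFlow g)
    (hinv : ∀ t, 0 ≤ t → IsLeftInvariantMetric (g t)) {t : ℝ} (ht : 0 ≤ t) :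
    HasDerivWithinAt (fun s => (g s 0).det) (g t 0 2 2 ^ 2) (Ici 0) t := by
  obtain ⟨a, α, β, P, Q, R, ha, hP, hR, hΔ, e⟩ :=
    exists_eq_heisMetric (hg.metric t ht) (hinv t ht)
  have h := fun i j => hg.flow t ht 0 i j
  simp only [Matrix.det_fin_three]
  refine (((((((((h 0 0).fun_mul (h 1 1)).fun_mul (h 2 2)).fun_sub
    (((h 0 0).fun_mul (h 1 2)).fun_mul (h 2 1))).fun_sub
    (((h 0 1).fun_mul (h 1 0)).fun_mul (h 2 2))).fun_add
    (((h 0 1).fun_mul (h 1 2)).fun_mul (h 2 0))).fun_add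
    (((h 0 2).fun_mul (h 1 0)).fun_mul (h 2 1))).fun_sub
    (((h 0 2).fun_mul (h 1 1)).fun_mul (h 2 0)))).congr_deriv ?_
  rw [e, ricci_heisMetric α β ha.ne' hΔ.ne']
  simp [heisMetric, heisRicci, contactForm, horizontalForm]
  field_simp
  ring

theorem IsRiemannianMetric.central_pos {g : TensorField} (hg : IsRiemannianMetric g) (x : E3) :
    0 < g x 2 2 :=
  (hg.posDef x).diag_pos

theorem IsRiemannianMetric.det_pos {g : TensorField} (hg : IsRiemannianMetric g) (x : E3) :
    0 < (g x).det :=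
  (hg.posDef x).det_pos

theorem central_mul_det_eq {g : ℝ → TensorField} (hg : IsRicciFlow g)
    (hinv : ∀ t, 0 ≤ t → IsLeftInvariantMetric (g t)) {t : ℝ} (ht : 0 ≤ t) :
    g t 0 2 2 * (g t 0).det = g 0 0 2 2 * (g 0 0).det := by
  refine eq_initial_of_hasDerivWithinAt_zero (f := fun t => g t 0 2 2 * (g t 0).det)
    (fun s hs => ?_) ht
  refine ((hasDerivWithinAt_central hg hinv hs).fun_mul
    (hasDerivWithinAt_det hg hinv hs)).congr_deriv ?_
  have := ((hg.metric s hs).det_pos 0).ne'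
  field_simp
  ring

theorem det_div_central_sq_eq {g : ℝ → TensorField} (hg : IsRicciFlow g)
    (hinv : ∀ t, 0 ≤ t → IsLeftInvariantMetric (g t)) {t : ℝ} (ht : 0 ≤ t) :
    (g t 0).det / g t 0 2 2 ^ 2 = (g 0 0).det / g 0 0 2 2 ^ 2 + 3 * t := by
  have h := eq_initial_of_hasDerivWithinAt_zero
    (f := fun t => (g t 0).det / g t 0 2 2 ^ 2 - 3 * t) (fun s hs => ?_) ht
  · simp only [mul_zero, sub_zero] at h
    linarith only [h]
  · have ha := ((hg.metric s hs).central_pos 0).ne'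
    have hd := ((hg.metric s hs).det_pos 0).ne'
    refine (((hasDerivWithinAt_det hg hinv hs).fun_div
      ((hasDerivWithinAt_central hg hinv hs).fun_pow 2) (pow_ne_zero 2 ha)).fun_sub
      ((hasDerivWithinAt_id s _).const_mul 3)).congr_deriv ?_
    field_simp
    ring

/-- Rewrites `a²Δ` as `a/(D/a²)`, whose denominator is affine in time along the flow. -/
theorem cottonL1_eq {g : TensorField} (hg : IsRiemannianMetric g) (hinv : IsLeftInvariantMetric g)
    (K : Set E3) :
    cottonL1 K g = Real.sqrt (3 / 2) * (g 0 2 2 / ((g 0).det / g 0 2 2 ^ 2)) * (volume K).toReal := by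
  obtain ⟨a, α, β, P, Q, R, ha, hP, hR, hΔ, rfl⟩ := exists_eq_heisMetric hg hinv
  rw [cottonL1_heisMetric α β ha hΔ, heisMetric_det α β hΔ.ne']
  simp [heisMetric, contactForm, horizontalForm]
  left
  field_simp

/-! ### Existence of the flow. -/

theorem mul_horizontalForm {P Q R : ℝ} (hΔ : P * R - Q ^ 2 ≠ 0) (i j : Fin 3) :
    (P * R - Q ^ 2) * horizontalForm P Q R i j = !![R, -Q, 0; -Q, P, 0; 0, 0, 0] i j := by
  rw [horizontalForm, Matrix.smul_apply, smul_eq_mul, mul_inv_cancel_left₀ hΔ]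

/-- The ansatz `φ⁻¹ aθ² + φ S` reduces the flow to `φ' = aΔ/φ²`, `φ(0) = 1`, with `a` and `Δ` the
initial values; thus `φ³ = 1 + 3aΔt`. Scaling `S` by `φ` divides `P, Q, R` by `φ`. -/
theorem exists_isRicciFlow {a P Q R : ℝ} (α β : ℝ) (ha : 0 < a) (hP : 0 < P)
    (hΔ : 0 < P * R - Q ^ 2) :
    ∃ g : ℝ → TensorField, IsRicciFlow g ∧ (∀ t, 0 ≤ t → IsLeftInvariantMetric (g t)) ∧
      g 0 = heisMetric a α β P Q R := by
  have hφ : ∀ t : ℝ, 0 ≤ t → 0 < 1 + 3 * (a * (P * R - Q ^ 2)) * t := fun t ht => by positivity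
  obtain ⟨φ, hφdef⟩ : ∃ φ : ℝ → ℝ,
      φ = fun t => (1 + 3 * (a * (P * R - Q ^ 2)) * t) ^ (1 / 3 : ℝ) := ⟨_, rfl⟩
  have hpos : ∀ t, 0 ≤ t → 0 < φ t := fun t ht => by
    rw [hφdef]
    exact Real.rpow_pos_of_pos (hφ t ht) _
  have hderiv : ∀ t, 0 ≤ t → HasDerivAt φ (a * (P * R - Q ^ 2) / φ t ^ 2) t := fun t ht => by
    have h1 : HasDerivAt (fun t => 1 + 3 * (a * (P * R - Q ^ 2)) * t)
        (3 * (a * (P * R - Q ^ 2))) t := by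
      simpa using ((hasDerivAt_id t).const_mul (3 * (a * (P * R - Q ^ 2)))).const_add 1
    have h2 := h1.rpow_const (p := 1 / 3) (Or.inl (hφ t ht).ne')
    rw [hφdef]
    refine h2.congr_deriv ?_
    rw [show (1 / 3 - 1 : ℝ) = -(1 / 3 * (2 : ℕ)) by norm_num, Real.rpow_neg (hφ t ht).le,
      Real.rpow_mul_natCast (hφ t ht).le]
    ring
  have hΔt : ∀ t, 0 ≤ t → 0 < P / φ t * (R / φ t) - (Q / φ t) ^ 2 := fun t ht => by
    have := hpos t ht
    rw [show P / φ t * (R / φ t) - (Q / φ t) ^ 2 = (P * R - Q ^ 2) / φ t ^ 2 by ring]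
    positivity
  refine ⟨fun t => heisMetric (a / φ t) α β (P / φ t) (Q / φ t) (R / φ t), ⟨fun t ht => ?_,
    fun t ht x i j => ?_⟩, fun t _ => isLeftInvariantMetric_heisMetric _ _ _ _ _ _, ?_⟩
  · exact isRiemannianMetric_heisMetric α β (div_pos ha (hpos t ht)) (div_pos hP (hpos t ht))
      (hΔt t ht)
  · have hne := (hpos t ht).ne'
    have hd := ((hderiv t ht).fun_inv hne).mul_const
      (a * contactForm α (β - x 0) i * contactForm α (β - x 0) j) |>.fun_add
      ((hderiv t ht).mul_const (horizontalForm P Q R i j)) |>.hasDerivWithinAt (s := Ici 0)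
    have hform : ∀ s, 0 ≤ s → heisMetric (a / φ s) α β (P / φ s) (Q / φ s) (R / φ s) x i j
        = (φ s)⁻¹ * (a * contactForm α (β - x 0) i * contactForm α (β - x 0) j)
          + φ s * horizontalForm P Q R i j := fun s hs => by
      have hs' := (hpos s hs).ne'
      have e : horizontalForm (P / φ s) (Q / φ s) (R / φ s) i j
          = φ s * horizontalForm P Q R i j := by
        rw [horizontalForm, horizontalForm,
          show P / φ s * (R / φ s) - (Q / φ s) ^ 2 = (P * R - Q ^ 2) / φ s ^ 2 by ring]
        fin_cases i <;> fin_cases j <;> simp <;> field_simp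
      rw [heisMetric, Matrix.of_apply, e]
      ring
    refine (hd.congr hform (hform t ht)).congr_deriv ?_
    rw [ricci_heisMetric α β (div_pos ha (hpos t ht)).ne' (hΔt t ht).ne']
    have e2 : !![R / φ t, -(Q / φ t), 0; -(Q / φ t), P / φ t, 0; 0, 0, 0] i j
        = (φ t)⁻¹ * ((P * R - Q ^ 2) * horizontalForm P Q R i j) := by
      rw [mul_horizontalForm hΔ.ne']
      fin_cases i <;> fin_cases j <;> simp [div_eq_inv_mul]
    beta_reduce
    rw [heisRicci, Matrix.of_apply, e2]
    field_simp
    ring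
  · have h0 : φ 0 = 1 := by simp [hφdef]
    simp [h0]

/-! ### The explicit formula and its consequences. -/

theorem cottonL1_eq_of_isRicciFlow {g : ℝ → TensorField} {F : Fin 3 → E3 → E3} {A₀ B₀ C₀ : ℝ}
    (hF : IsMilnorFrame (g 0) F A₀ B₀ C₀) (hg : IsRicciFlow g)
    (hinv : ∀ t, 0 ≤ t → IsLeftInvariantMetric (g t)) (K : Set E3) {t : ℝ} (ht : 0 ≤ t) :
    cottonL1 K (g t) =
      4 * Real.sqrt 6 * A₀ ^ (2 / 3 : ℝ) * B₀ ^ (1 / 3 : ℝ) * C₀ ^ (1 / 3 : ℝ)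
        * (12 * t + B₀ * C₀ / A₀) ^ (-4 / 3 : ℝ)
        * (riemVol (diagMetric F ![1, 1, 1]) K).toReal := by
  obtain ⟨c, hc, hF0, hdet⟩ := hF.exists_central
  have hA := hF.posA
  have hB := hF.posB
  have hC := hF.posC
  have ha0 : g 0 0 2 2 = A₀ / c ^ 2 := hF.central_apply hc hF0 hdet 0
  have hD0 : (g 0 0).det = A₀ * B₀ * C₀ / (4 * c ^ 4) := by
    rw [hF.diagonal, det_diagMetric, hdet]
    simp
    ring
  have hvol : (riemVol (diagMetric F ![1, 1, 1]) K).toReal = (volume K).toReal / (2 * c ^ 2) := by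
    have h1 : ∀ x, (diagMetric F ![1, 1, 1] x).det = (1 / (2 * c ^ 2)) ^ 2 := fun x => by
      rw [det_diagMetric, hdet]
      simp
      ring
    rw [riemVol_of_det_eq h1, Real.sqrt_sq (by positivity), Measure.smul_apply, smul_eq_mul,
      ENNReal.toReal_mul, ENNReal.toReal_ofReal (by positivity)]
    ring
  have hu : 0 < 12 * t + B₀ * C₀ / A₀ := by positivity
  have hv : (g t 0).det / g t 0 2 2 ^ 2 = (12 * t + B₀ * C₀ / A₀) / 4 := by
    rw [det_div_central_sq_eq hg hinv ht, ha0, hD0]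
    field_simp
    ring
  have hprod := central_mul_det_eq hg hinv ht
  rw [ha0, hD0] at hprod
  have hat := (hg.metric t ht).central_pos 0
  rw [cottonL1_eq (hg.metric t ht) (hinv t ht), hvol, hv]
  generalize g t 0 2 2 = a at *
  generalize (g t 0).det = D at *
  generalize 12 * t + B₀ * C₀ / A₀ = u at *
  have hD : D = u / 4 * a ^ 2 := by
    rw [← hv]
    field_simp
  -- Substituting `D = (u/4) a²` into the conserved product `aD` gives `a³ = A₀²B₀C₀/(c⁶u)`;
  -- positivity then selects the cube root.
  have hcube : a ^ 3 = (A₀ ^ (2 / 3 : ℝ) * B₀ ^ (1 / 3 : ℝ) * C₀ ^ (1 / 3 : ℝ)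
      * u ^ (-1 / 3 : ℝ) / c ^ 2) ^ 3 := by
    have hpow : ∀ x y : ℝ, 0 < x → (x ^ y) ^ 3 = x ^ (y * 3) := fun x y hx => by
      rw [← Real.rpow_natCast, ← Real.rpow_mul hx.le]
      norm_num
    rw [div_pow, mul_pow, mul_pow, mul_pow, hpow _ _ hA, hpow _ _ hB, hpow _ _ hC, hpow _ _ hu,
      show (2 / 3 * 3 : ℝ) = (2 : ℕ) by norm_num, show (1 / 3 * 3 : ℝ) = 1 by norm_num,
      show (-1 / 3 * 3 : ℝ) = -1 by norm_num, Real.rpow_natCast, Real.rpow_one, Real.rpow_one,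
      Real.rpow_neg_one]
    rw [hD] at hprod
    field_simp at hprod ⊢
    linear_combination hprod
  have ha : a = A₀ ^ (2 / 3 : ℝ) * B₀ ^ (1 / 3 : ℝ) * C₀ ^ (1 / 3 : ℝ)
      * u ^ (-1 / 3 : ℝ) / c ^ 2 :=
    (pow_left_inj₀ hat.le (by positivity) (by norm_num)).1 hcube
  have hsqrt : Real.sqrt (3 / 2) = Real.sqrt 6 / 2 := by
    rw [show (3 / 2 : ℝ) = 6 / 2 ^ 2 by norm_num, Real.sqrt_div (by norm_num),
      Real.sqrt_sq (by norm_num)]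
  rw [show (-4 / 3 : ℝ) = -1 / 3 - 1 by norm_num, Real.rpow_sub_one hu.ne', ha, hsqrt]
  field_simp

theorem strictAntiOn_rpow_affine {u₀ k : ℝ} (hu : 0 < u₀) (hk : 0 < k) :
    StrictAntiOn (fun t : ℝ => k * (12 * t + u₀) ^ (-4 / 3 : ℝ)) (Ici 0) := by
  intro s hs t _ hst
  have hs' : (0 : ℝ) ≤ s := hs
  exact mul_lt_mul_of_pos_left
    (Real.rpow_lt_rpow_of_neg (by positivity) (by linarith) (by norm_num)) hk

theorem tendsto_rpow_affine (u₀ k : ℝ) :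
    Tendsto (fun t : ℝ => k * (12 * t + u₀) ^ (-4 / 3 : ℝ)) atTop (𝓝 0) := by
  have h1 : Tendsto (fun t : ℝ => 12 * t + u₀) atTop atTop :=
    tendsto_atTop_add_const_right _ _ (tendsto_id.const_mul_atTop (by norm_num))
  have h2 := ((tendsto_rpow_neg_atTop (y := 4 / 3) (by norm_num)).comp h1).const_mul k
  rw [mul_zero] at h2
  refine h2.congr fun t => ?_
  rw [Function.comp_apply, neg_div]

theorem IsMilnorFrame.riemVol_lt_top {g : TensorField} {F : Fin 3 → E3 → E3} {A₀ B₀ C₀ : ℝ}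
    (h : IsMilnorFrame g F A₀ B₀ C₀) (d : Fin 3 → ℝ) {K : Set E3} (hK : IsCompact K) :
    riemVol (diagMetric F d) K < ⊤ := by
  obtain ⟨c, -, -, hdet⟩ := h.exists_central
  have h1 : ∀ x, (diagMetric F d x).det = d 0 * d 1 * d 2 / (-2 * c ^ 2) ^ 2 := fun x => by
    rw [det_diagMetric, hdet]
  rw [riemVol_of_det_eq h1, Measure.smul_apply, smul_eq_mul]
  exact ENNReal.mul_lt_top ENNReal.ofReal_lt_top hK.measure_lt_top

end CottonFlow

open CottonFlow
theorem theorem3p8 (g₀ : TensorField) (hg₀ : IsRiemannianMetric g₀)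
    (hinv : IsLeftInvariantMetric g₀) :
    -- a Milnor frame for the initial metric exists
    (∃ (F : Fin 3 → E3 → E3) (A₀ B₀ C₀ : ℝ), IsMilnorFrame g₀ F A₀ B₀ C₀) ∧
    -- the left-invariant Ricci flow starting at the initial metric exists for all `t ≥ 0`
    (∃ g : ℝ → TensorField,
      IsRicciFlow g ∧ (∀ t, 0 ≤ t → IsLeftInvariantMetric (g t)) ∧ g 0 = g₀) ∧
    -- the behaviour of the `L¹`-norm of the Cotton–York tensor
    (∀ (F : Fin 3 → E3 → E3) (A₀ B₀ C₀ : ℝ), IsMilnorFrame g₀ F A₀ B₀ C₀ →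
      ∀ g : ℝ → TensorField, IsRicciFlow g → (∀ t, 0 ≤ t → IsLeftInvariantMetric (g t)) →
        g 0 = g₀ →
        ∀ K : Set E3, IsCompact K →
          (∀ t, 0 ≤ t →
            cottonL1 K (g t) =
              4 * Real.sqrt 6 * A₀ ^ (2 / 3 : ℝ) * B₀ ^ (1 / 3 : ℝ) * C₀ ^ (1 / 3 : ℝ)
                * (12 * t + B₀ * C₀ / A₀) ^ (-4 / 3 : ℝ)
                * (riemVol (diagMetric F ![1, 1, 1]) K).toReal) ∧
          (0 < riemVol (diagMetric F ![1, 1, 1]) K →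
            StrictAntiOn (fun t => cottonL1 K (g t)) (Ici 0)) ∧
          Tendsto (fun t => cottonL1 K (g t)) atTop (𝓝 0)) := by
  refine ⟨?_, ?_, ?_⟩
  · obtain ⟨a, α, β, P, Q, R, ha, hP, hR, hΔ, rfl⟩ := exists_eq_heisMetric hg₀ hinv
    exact exists_isMilnorFrame α β ha hR hΔ
  · obtain ⟨a, α, β, P, Q, R, ha, hP, hR, hΔ, rfl⟩ := exists_eq_heisMetric hg₀ hinv
    exact exists_isRicciFlow α β ha hP hΔ
  · rintro F A₀ B₀ C₀ hF g hg hginv rfl K hK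
    have hA := hF.posA
    have hB := hF.posB
    have hC := hF.posC
    have key := fun t (ht : 0 ≤ t) => cottonL1_eq_of_isRicciFlow hF hg hginv K ht
    have key' : EqOn (fun t => 4 * Real.sqrt 6 * A₀ ^ (2 / 3 : ℝ) * B₀ ^ (1 / 3 : ℝ)
        * C₀ ^ (1 / 3 : ℝ) * (riemVol (diagMetric F ![1, 1, 1]) K).toReal
          * (12 * t + B₀ * C₀ / A₀) ^ (-4 / 3 : ℝ)) (fun t => cottonL1 K (g t)) (Ici 0) :=
      fun t ht => by
        simp only [key t ht]
        ring
    refine ⟨key, fun hvol => ?_, ?_⟩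
    · have hv := ENNReal.toReal_pos hvol.ne' (hF.riemVol_lt_top _ hK).ne
      exact (strictAntiOn_rpow_affine (by positivity) (by positivity)).congr key'
    · exact (tendsto_rpow_affine _ _).congr' ((eventually_ge_atTop 0).mono key')
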